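/- Let $(X,\mathscr B,\nu)$ be a $\sigma$-finite measure space, $\mathscr B_{fin}=\{A\in\mathscr B:\nu(A)<\infty\}$, and write $L^2(\nu)$ for the real $L^2$-space. Let $K:\mathscr B_{fin}\times\mathscr B_{fin}\to\mathbb R$ have a factorization $K(A,B)=\langle k_A,k_B\rangle_{L^2(\nu)}$ with $k_A\in L^2(\nu)$, and let $S$ be a closed linear operator in $L^2(\nu)$ (for example a self-adjoint one) such that $\mathscr D_{fin}=\operatorname{span}\{\chi_A: A\in\mathscr B_{fin}\}$ is a core for $S$ and $S\chi_A=k_A$ for all $A\in\mathscr B_{fin}$. Let $\dot{\mathbb R}$ be the one-point compactification of $\mathbb R$, $\Omega=\dot{\mathbb R}^{\mathscr B_{fin}}$ with its cylinder $\sigma$-algebra $\mathscr C$, and let $\mathbb P$ be the Gaussian measure on $(\Omega,\mathscr C)$ for which, with $W_A(\omega)=\omega(A)$, every $(W_{A_1},\dots,W_{A_n})$ has the centred Gaussian law on $\mathbb R^n$ with covariance matrix $(K(A_i,A_j))_{i,j}$. For a countable partition $\{A_i\}\subset\mathscr B_{fin}$ of $X$ and a step function $\varphi=\sum_i\alpha_i\chi_{A_i}$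 (finitely many $\alpha_i\neq0$) put $\int\varphi\,dW=\sum_i\alpha_iW_{A_i}$. For a measurable $\varphi:X\to\mathbb R$, a random variable $F$ is called (a version of) the Itô integral $\int\varphi\,dW$ if there are step functions $\varphi_n$ of this kind (the partition may depend on $n$) with $\varphi_n\to\varphi$ in $L^2(\nu)$ and $\int\varphi_n\,dW\to F$ in $\mathbb P$-probability. Then, for measurable $\varphi,\psi:X\to\mathbb R$: 1. the Itô integral $\int\varphi\,dW$ exists and lies in $L^2(\Omega,\mathscr C,\mathbb P)$ if and only if $\varphi\in\operatorname{dom}(S)$ (that is, $\varphi\in L^2(\nu)$ and its class belongs to the domain of $S$); 2. if $\varphi\in\operatorname{dom}(S)$, then every version of $\int\varphi\,dW$ lies in $L^2(\Omega,\mathscr C,\mathbb P)$ and $\mathbb E\big(|\int\varphi\,dW|^2\big)=\|S\varphi\|_{L^2(\nu)}^2$; if also $\psi\in\operatorname{dom}(S)$, then $(\int\varphi\,dW)(\int\psi\,dW)$ is integrable and $\mathbb E\big((\int\varphi\,dW)(\int\psi\,dW)\big)=\langle S\varphi,S\psi\rangle_{L^2(\nu)}$. -/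

import Mathlib

open MeasureTheory ProbabilityTheory Filter Topology
open scoped ENNReal

namespace KernelField

/-- The Borel sigma-algebra of the one-point compactification of the real line. -/
instance instMeasurableSpaceOnePointReal : MeasurableSpace (OnePoint ℝ) := borel (OnePoint ℝ)

instance instBorelSpaceOnePointReal : BorelSpace (OnePoint ℝ) := ⟨rfl⟩

variable {X : Type*} [MeasurableSpace X]

/-- The measurable sets of finite `ν`-measure. -/
abbrev Bfin (ν : Measure X) : Type _ := {A : Set X // MeasurableSet A ∧ ν A < ∞}

/-- The indicator function of `A`, as an element of `L²(ν)`. -/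
noncomputable def chi (ν : Measure X) (A : Bfin ν) : Lp ℝ 2 ν :=
  indicatorConstLp 2 A.2.1 A.2.2.ne (1 : ℝ)

/-- The span in `L²(ν)` of the indicator functions of sets of finite measure. -/
noncomputable def Dfin (ν : Measure X) : Submodule ℝ (Lp ℝ 2 ν) :=
  Submodule.span ℝ (Set.range (chi ν))

/-- The path space; it carries the product (cylinder) sigma-algebra. -/
abbrev PathSpace (ν : Measure X) : Type _ := Bfin ν → OnePoint ℝ

/-- The coordinate `ω ↦ ω A` as a real random variable. The point at infinity, which the
coordinates hit with probability zero, is sent to `0`. -/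
def W (ν : Measure X) (A : Bfin ν) (ω : PathSpace ν) : ℝ := (ω A).elim 0 id

/-- `P` is the Gaussian measure on path space indexed by `K`: for every finite family
`A₁, …, Aₙ`, the law of `(ω A₁, …, ω Aₙ)` is the centred Gaussian on `ℝⁿ` with covariance
matrix `(K Aᵢ Aⱼ)`, transported to the product of the compactifications. -/
def IsGaussianPathMeasure (ν : Measure X) (K : Bfin ν → Bfin ν → ℝ)
    (P : Measure (PathSpace ν)) : Prop :=
  ∀ (n : ℕ) (A : Fin n → Bfin ν),
    P.map (fun ω i => ω (A i)) =
      (multivariateGaussian 0 (Matrix.of fun i j => K (A i) (A j))).map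
        (fun (x : EuclideanSpace ℝ (Fin n)) i => ((x i : ℝ) : OnePoint ℝ))

/-- A countable partition of `X` into sets of finite measure; cells may be empty, so finite
partitions are included. -/
structure Partition (ν : Measure X) where
  cell : ℕ → Bfin ν
  disjoint : Pairwise fun i j => Disjoint (cell i : Set X) (cell j : Set X)
  cover : ⋃ i, (cell i : Set X) = Set.univ

/-- The step function `∑ αᵢ χ_{Aᵢ}` on the cells of a partition (finitely many `αᵢ ≠ 0`). -/
noncomputable def Partition.step {ν : Measure X} (𝒜 : Partition ν) (α : ℕ →₀ ℝ) (x : X) : ℝ :=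
  ∑ i ∈ α.support, α i * (𝒜.cell i : Set X).indicator (fun _ => (1 : ℝ)) x

/-- The Itô integral `∑ αᵢ W_{Aᵢ}` of the step function `∑ αᵢ χ_{Aᵢ}`. -/
noncomputable def Partition.stepIto {ν : Measure X} (𝒜 : Partition ν) (α : ℕ →₀ ℝ)
    (ω : PathSpace ν) : ℝ :=
  ∑ i ∈ α.support, α i * W ν (𝒜.cell i) ω

/-- The random variable `F` is (a version of) the Itô integral `∫ φ dW`: there are step functions
over partitions which converge to `φ` in `L²(ν)` and whose Itô integrals converge to `F` in
probability. Square integrability of `F` is not part of the definition. -/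
def IsItoIntegral (ν : Measure X) (P : Measure (PathSpace ν)) (φ : X → ℝ)
    (F : PathSpace ν → ℝ) : Prop :=
  ∃ (𝒜 : ℕ → Partition ν) (α : ℕ → ℕ →₀ ℝ),
    Tendsto (fun n => eLpNorm (fun x => (𝒜 n).step (α n) x - φ x) 2 ν) atTop (𝓝 0) ∧
    TendstoInMeasure P (fun n => (𝒜 n).stepIto (α n)) atTop F

end KernelField

/-!
The Itô integral of `φ` is `V (S φ)`, where `V` extends `k A ↦ W A` to an isometry of the closed
span of the `k A` into `L²(P)`. Centred Gaussian variables that converge in probability form a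
Cauchy sequence in `L²`, because such a variable exceeds its own standard deviation with a
probability that does not depend on the variable. Hence the pairs `(φₙ, S φₙ)` attached to step
functions whose Itô integrals converge in probability converge themselves, and their limits are
exactly the points of the closure of the graph of `S` on step functions, which is the graph of `S`
since `S` is closed and the step functions are a core.
-/

namespace KernelField

section IsometricExtension

variable {𝕜 ι E H : Type*} [RCLike 𝕜]
  [NormedAddCommGroup E] [InnerProductSpace 𝕜 E]
  [NormedAddCommGroup H] [InnerProductSpace 𝕜 H]

lemma exists_continuousLinearMap_comp_eq_of_norm_le {M F : Type*} [AddCommGroup M] [Module 𝕜 M]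
    [NormedAddCommGroup F] [NormedSpace 𝕜 F] [CompleteSpace F] [CompleteSpace H]
    (f : M →ₗ[𝕜] F) (e : M →ₗ[𝕜] H) {C : ℝ} (hfe : ∀ x, ‖f x‖ ≤ C * ‖e x‖) :
    ∃ V : H →L[𝕜] F, ∀ x, V (e x) = f x := by
  let R := LinearMap.range e
  let e' : M →ₗ[𝕜] R.topologicalClosure :=
    e.codRestrict _ fun x => R.le_topologicalClosure (LinearMap.mem_range_self e x)
  have he' : DenseRange e' := by
    have hdense := denseRange_inclusion_iff R.le_topologicalClosure |>.2 subset_rfl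
    exact hdense.comp e.surjective_rangeRestrict.denseRange (by fun_prop)
  refine ⟨(f.extendOfNorm e').comp R.topologicalClosure.orthogonalProjectionOnto, fun x => ?_⟩
  have hproj : R.topologicalClosure.orthogonalProjectionOnto (e x) = e' x :=
    Submodule.orthogonalProjectionOnto_mem_subspace_eq_self (e' x)
  rw [ContinuousLinearMap.comp_apply, hproj]
  exact LinearMap.extendOfNorm_eq he' ⟨C, hfe⟩ x

lemma norm_linearCombination_eq_of_inner_eq {a : ι → E} {b : ι → H}
    (hab : ∀ i j, inner 𝕜 (a i) (a j) = inner 𝕜 (b i) (b j)) (c : ι →₀ 𝕜) :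
    ‖Finsupp.linearCombination 𝕜 a c‖ = ‖Finsupp.linearCombination 𝕜 b c‖ := by
  simp only [norm_eq_sqrt_re_inner (𝕜 := 𝕜), Finsupp.linearCombination_apply, Finsupp.sum,
    sum_inner, inner_sum, inner_smul_left, inner_smul_right, hab]

lemma inner_map_map_of_mem_topologicalClosure_span {V : H →L[𝕜] E} {b : ι → H}
    (hV : ∀ i j, inner 𝕜 (V (b i)) (V (b j)) = inner 𝕜 (b i) (b j)) {x y : H}
    (hx : x ∈ (Submodule.span 𝕜 (Set.range b)).topologicalClosure)
    (hy : y ∈ (Submodule.span 𝕜 (Set.range b)).topologicalClosure) :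
    inner 𝕜 (V x) (V y) = inner 𝕜 x y := by
  have extend (z : H) (hz : ∀ i, inner 𝕜 (V z) (V (b i)) = inner 𝕜 z (b i)) {w : H}
      (hw : w ∈ (Submodule.span 𝕜 (Set.range b)).topologicalClosure) :
      inner 𝕜 (V z) (V w) = inner 𝕜 z w :=
    ContinuousLinearMap.eqOn_closure_span (f := (innerSL 𝕜 (V z)).comp V) (g := innerSL 𝕜 z)
      (Set.forall_mem_range.2 hz) hw
  refine extend x (fun i => ?_) hy
  rw [← inner_conj_symm, extend (b i) (hV i) hx, inner_conj_symm]

theorem exists_continuousLinearMap_isometric_on_closure_span [CompleteSpace E] [CompleteSpace H]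
    {a : ι → E} {b : ι → H} (hab : ∀ i j, inner 𝕜 (a i) (a j) = inner 𝕜 (b i) (b j)) :
    ∃ V : H →L[𝕜] E, (∀ i, V (b i) = a i) ∧
      ∀ x ∈ (Submodule.span 𝕜 (Set.range b)).topologicalClosure,
      ∀ y ∈ (Submodule.span 𝕜 (Set.range b)).topologicalClosure,
        inner 𝕜 (V x) (V y) = inner 𝕜 x y := by
  obtain ⟨V, hV⟩ := exists_continuousLinearMap_comp_eq_of_norm_le (C := 1)
    (Finsupp.linearCombination 𝕜 a) (Finsupp.linearCombination 𝕜 b) fun c => by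
      rw [one_mul, norm_linearCombination_eq_of_inner_eq hab]
  have hVb (i : ι) : V (b i) = a i := by simpa using hV (Finsupp.single i 1)
  exact ⟨V, hVb, fun x hx y hy =>
    inner_map_map_of_mem_topologicalClosure_span (fun i j => by simp only [hVb, hab]) hx hy⟩

end IsometricExtension

section ClosedOperator

variable {R ι E F : Type*} [CommRing R] [AddCommGroup E] [AddCommGroup F] [Module R E] [Module R F]
  {S : E →ₗ.[R] F} {e : ι → E} {k : ι → F}

lemma linearCombination_prodMk (e : ι → E) (k : ι → F) (c : ι →₀ R) :
    Finsupp.linearCombination R (fun i => (e i, k i)) c =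
      (Finsupp.linearCombination R e c, Finsupp.linearCombination R k c) := by
  simp only [Finsupp.linearCombination_apply, Finsupp.sum, Prod.ext_iff, Prod.fst_sum, Prod.snd_sum,
    Prod.smul_mk, and_self]

lemma fst_mem_span_of_mem_span_prodMk {w : E × F}
    (hw : w ∈ Submodule.span R (Set.range fun i => (e i, k i))) :
    w.1 ∈ Submodule.span R (Set.range e) := by
  obtain ⟨c, rfl⟩ := Finsupp.mem_span_range_iff_exists_finsupp.1 hw
  exact Finsupp.mem_span_range_iff_exists_finsupp.2
    ⟨c, (congrArg Prod.fst (linearCombination_prodMk e k c)).symm⟩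

lemma span_range_prodMk_le_graph (hSk : ∀ i, (e i, k i) ∈ S.graph) :
    Submodule.span R (Set.range fun i => (e i, k i)) ≤ S.graph :=
  Submodule.span_le.2 (Set.range_subset_iff.2 hSk)

lemma linearCombination_mem_graph (hSk : ∀ i, (e i, k i) ∈ S.graph) (c : ι →₀ R) :
    (Finsupp.linearCombination R e c, Finsupp.linearCombination R k c) ∈ S.graph := by
  rw [← linearCombination_prodMk]
  exact span_range_prodMk_le_graph hSk
    (Finsupp.mem_span_range_iff_exists_finsupp.2 ⟨c, rfl⟩)

lemma graph_domRestrict_span_le (hSk : ∀ i, (e i, k i) ∈ S.graph) :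
    (S.domRestrict (Submodule.span R (Set.range e))).graph ≤
      Submodule.span R (Set.range fun i => (e i, k i)) := by
  rintro ⟨u, v⟩ huv
  obtain ⟨c, hc⟩ := Finsupp.mem_span_range_iff_exists_finsupp.1
    (LinearPMap.mem_domain_of_mem_graph huv).1
  have hv : Finsupp.linearCombination R k c = v := S.mem_graph_snd_inj
    (linearCombination_mem_graph hSk c) (LinearPMap.le_graph_of_le S.domRestrict_le huv) hc
  exact Finsupp.mem_span_range_iff_exists_finsupp.2
    ⟨c, (linearCombination_prodMk e k c).trans (Prod.ext hc hv)⟩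

lemma graph_eq_topologicalClosure_span [TopologicalSpace E] [TopologicalSpace F]
    [ContinuousAdd E] [ContinuousAdd F] [TopologicalSpace R] [ContinuousSMul R E]
    [ContinuousSMul R F] (hS : S.IsClosed) (hcore : S.HasCore (Submodule.span R (Set.range e)))
    (hSk : ∀ i, (e i, k i) ∈ S.graph) :
    S.graph = (Submodule.span R (Set.range fun i => (e i, k i))).topologicalClosure := by
  apply le_antisymm
  · have hclosable : (S.domRestrict (Submodule.span R (Set.range e))).IsClosable :=
      hS.isClosable.leIsClosable S.domRestrict_le
    nth_rw 1 [← hcore.closure_eq, ← hclosable.graph_closure_eq_closure_graph]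
    exact Submodule.topologicalClosure_mono (graph_domRestrict_span_le hSk)
  · exact Submodule.topologicalClosure_minimal _ (span_range_prodMk_le_graph hSk) hS

end ClosedOperator

section GaussianLimit

variable {Ω : Type*} [MeasurableSpace Ω] {P : Measure Ω}

lemma integral_mul_eq_inner_of_ae_eq {F G : Ω → ℝ} {u v : Lp ℝ 2 P} (hF : F =ᵐ[P] u)
    (hG : G =ᵐ[P] v) : ∫ ω, F ω * G ω ∂P = inner ℝ u v := by
  rw [L2.inner_def]
  refine integral_congr_ae ?_
  filter_upwards [hF, hG] with ω hFω hGω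
  simp [hFω, hGω, mul_comm]

lemma map_eq_gaussianReal_norm_sq {Z : Lp ℝ 2 P} (hZ : HasGaussianLaw Z P)
    (hZ0 : ∫ ω, Z ω ∂P = 0) : P.map Z = gaussianReal 0 (‖Z‖ ^ 2).toNNReal := by
  rw [hZ.map_eq_gaussianReal, hZ0, variance_of_integral_eq_zero hZ.aemeasurable hZ0,
    ← real_inner_self_eq_norm_sq, ← integral_mul_eq_inner_of_ae_eq .rfl .rfl]
  simp only [sq]

lemma gaussianReal_one_le_abs_pos : 0 < gaussianReal 0 1 {x | 1 ≤ |x|} := by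
  have hvol : volume {x : ℝ | 1 ≤ |x|} ≠ 0 := fun h => by
    have hIcc : volume (Set.Icc (1 : ℝ) 2) = 0 :=
      measure_mono_null (fun x hx => hx.1.trans (le_abs_self x)) h
    norm_num at hIcc
  exact pos_iff_ne_zero.2 fun h => hvol (gaussianReal_absolutelyContinuous' 0 one_ne_zero h)

lemma gaussianReal_one_le_abs_le {σ ε : ℝ} (hεσ : ε ≤ σ) :
    gaussianReal 0 1 {x | 1 ≤ |x|} ≤ gaussianReal 0 (σ ^ 2).toNNReal {x | ε ≤ |x|} := by
  have hscale : (gaussianReal 0 1).map (σ * ·) = gaussianReal 0 (σ ^ 2).toNNReal := by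
    rw [gaussianReal_map_const_mul, mul_zero, mul_one, Real.toNNReal_of_nonneg (sq_nonneg σ)]
  rw [← hscale, Measure.map_apply (by fun_prop) (measurableSet_le measurable_const (by fun_prop))]
  refine measure_mono fun x (hx : 1 ≤ |x|) => ?_
  calc ε ≤ |σ| * 1 := by rw [mul_one]; exact hεσ.trans (le_abs_self σ)
    _ ≤ |σ| * |x| := by gcongr
    _ = |σ * x| := (abs_mul σ x).symm

lemma measure_le_abs_sub_le (Y Z F : Ω → ℝ) (ε : ℝ) :
    P {ω | ε ≤ |Y ω - Z ω|} ≤ P {ω | ε / 2 ≤ ‖Y ω - F ω‖} + P {ω | ε / 2 ≤ ‖Z ω - F ω‖} := by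
  refine (measure_mono fun ω (hω : ε ≤ |Y ω - Z ω|) => ?_).trans (measure_union_le _ _)
  by_contra! hcon
  simp only [Set.mem_union, Set.mem_ofPred_eq, not_or, not_le, Real.norm_eq_abs] at hcon
  have htri := abs_sub_le (Y ω) (F ω) (Z ω)
  rw [abs_sub_comm (F ω)] at htri
  linarith [hcon.1, hcon.2]

theorem cauchySeq_of_tendstoInMeasure_of_hasGaussianLaw {Z : ℕ → Lp ℝ 2 P} {F : Ω → ℝ}
    (hlaw : ∀ m n, HasGaussianLaw (Z m - Z n : Lp ℝ 2 P) P)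
    (hmean : ∀ m n, ∫ ω, (Z m - Z n : Lp ℝ 2 P) ω ∂P = 0)
    (hF : TendstoInMeasure P (fun n => Z n) atTop F) : CauchySeq Z := by
  refine Metric.cauchySeq_iff'.2 fun ε hε => ?_
  rw [tendstoInMeasure_iff_norm] at hF
  obtain ⟨N, hN⟩ := eventually_atTop.1 ((hF (ε / 2) (half_pos hε)).eventually
    (gt_mem_nhds (ENNReal.half_pos gaussianReal_one_le_abs_pos.ne')))
  refine ⟨N, fun n hn => lt_of_not_ge fun hge => lt_irrefl (gaussianReal 0 1 {x | 1 ≤ |x|}) ?_⟩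
  rw [dist_eq_norm] at hge
  calc gaussianReal 0 1 {x | 1 ≤ |x|}
      ≤ gaussianReal 0 (‖Z n - Z N‖ ^ 2).toNNReal {x | ε ≤ |x|} := gaussianReal_one_le_abs_le hge
    _ = P {ω | ε ≤ |(Z n - Z N : Lp ℝ 2 P) ω|} := by
      rw [← map_eq_gaussianReal_norm_sq (hlaw n N) (hmean n N), Measure.map_apply_of_aemeasurable
        (hlaw n N).aemeasurable (measurableSet_le measurable_const (by fun_prop))]
      rfl
    _ = P {ω | ε ≤ |Z n ω - Z N ω|} := measure_congr <| by
      filter_upwards [Lp.coeFn_sub (Z n) (Z N)] with ω hω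
      exact congrArg (fun t => ε ≤ |t|) hω
    _ ≤ P {ω | ε / 2 ≤ ‖Z n ω - F ω‖} + P {ω | ε / 2 ≤ ‖Z N ω - F ω‖} :=
      measure_le_abs_sub_le _ _ F ε
    _ < gaussianReal 0 1 {x | 1 ≤ |x|} / 2 + gaussianReal 0 1 {x | 1 ≤ |x|} / 2 :=
      ENNReal.add_lt_add (hN n hn) (hN N le_rfl)
    _ = gaussianReal 0 1 {x | 1 ≤ |x|} := ENNReal.add_halves _

end GaussianLimit

section GaussianField

variable {Ω ι ι' H : Type*} [MeasurableSpace Ω] {P : Measure Ω}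
  [NormedAddCommGroup H] [InnerProductSpace ℝ H] {k : ι → H} {Y : ι → Ω → ℝ}

/-- A centred Gaussian process whose covariance kernel is factorized through the feature map `k`,
`E (Y s * Y t) = ⟪k s, k t⟫`. The covariance is centred at the mean, so that it gives the second
moments only together with `integral_eq_zero`. -/
structure IsGaussianField (k : ι → H) (Y : ι → Ω → ℝ) (P : Measure Ω) : Prop where
  isGaussianProcess : IsGaussianProcess Y P
  integral_eq_zero : ∀ s, ∫ ω, Y s ω ∂P = 0
  covariance_eq : ∀ s t, cov[Y s, Y t; P] = inner ℝ (k s) (k t)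

lemma coeFn_linearCombination_toLp {p : ℝ≥0∞} (hY : ∀ s, MemLp (Y s) p P) (c : ι →₀ ℝ) :
    Finsupp.linearCombination ℝ (fun s => (hY s).toLp (Y s)) c
      =ᵐ[P] fun ω => ∑ s ∈ c.support, c s * Y s ω := by
  rw [Finsupp.linearCombination_apply, Finsupp.sum]
  refine (Lp.coeFn_fun_finsetSum _ _).trans ?_
  have hterm : ∀ᵐ ω ∂P, ∀ s ∈ c.support, (c s • (hY s).toLp (Y s)) ω = c s * Y s ω := by
    refine (Finset.eventually_all _).2 fun s _ => ?_
    filter_upwards [Lp.coeFn_smul (c s) ((hY s).toLp (Y s)), (hY s).coeFn_toLp] with ω hsmul hs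
    rw [hsmul, Pi.smul_apply, hs, smul_eq_mul]
  filter_upwards [hterm] with ω hω using Finset.sum_congr rfl hω

namespace IsGaussianField

lemma memLp (hY : IsGaussianField k Y P) (s : ι) : MemLp (Y s) 2 P :=
  (hY.isGaussianProcess.hasGaussianLaw_eval s).memLp_two

lemma inner_toLp (hY : IsGaussianField k Y P) (s t : ι) :
    inner ℝ ((hY.memLp s).toLp (Y s)) ((hY.memLp t).toLp (Y t)) = inner ℝ (k s) (k t) := by
  have := hY.isGaussianProcess.isProbabilityMeasure
  rw [← hY.covariance_eq, covariance_eq_sub (hY.memLp s) (hY.memLp t), hY.integral_eq_zero,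
    zero_mul, sub_zero]
  exact (integral_mul_eq_inner_of_ae_eq (hY.memLp s).coeFn_toLp.symm
    (hY.memLp t).coeFn_toLp.symm).symm

variable [CompleteSpace H]

/-- The Wiener integral of a Gaussian field: the isometry `k s ↦ Y s` of the closed span of the
`k s` into `L²(P)`, extended to a continuous linear map on `H` to avoid a subtype domain. -/
noncomputable def wienerIntegral (hY : IsGaussianField k Y P) : H →L[ℝ] Lp ℝ 2 P :=
  (exists_continuousLinearMap_isometric_on_closure_span hY.inner_toLp).choose

lemma wienerIntegral_apply_self (hY : IsGaussianField k Y P) (s : ι) :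
    hY.wienerIntegral (k s) = (hY.memLp s).toLp (Y s) :=
  (exists_continuousLinearMap_isometric_on_closure_span hY.inner_toLp).choose_spec.1 s

lemma inner_wienerIntegral (hY : IsGaussianField k Y P) {g h : H}
    (hg : g ∈ (Submodule.span ℝ (Set.range k)).topologicalClosure)
    (hh : h ∈ (Submodule.span ℝ (Set.range k)).topologicalClosure) :
    inner ℝ (hY.wienerIntegral g) (hY.wienerIntegral h) = inner ℝ g h :=
  (exists_continuousLinearMap_isometric_on_closure_span hY.inner_toLp).choose_spec.2 g hg h hh

lemma norm_wienerIntegral (hY : IsGaussianField k Y P) {g : H}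
    (hg : g ∈ (Submodule.span ℝ (Set.range k)).topologicalClosure) :
    ‖hY.wienerIntegral g‖ = ‖g‖ := by
  rw [norm_eq_sqrt_real_inner, hY.inner_wienerIntegral hg hg, ← norm_eq_sqrt_real_inner]

lemma wienerIntegral_linearCombination_ae_eq (hY : IsGaussianField k Y P) (f : ι' → ι)
    (c : ι' →₀ ℝ) :
    hY.wienerIntegral (Finsupp.linearCombination ℝ (fun i => k (f i)) c)
      =ᵐ[P] fun ω => ∑ i ∈ c.support, c i * Y (f i) ω := by
  rw [← ContinuousLinearMap.coe_coe, LinearMap.map_finsupp_linearCombination]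
  simp only [Function.comp_def, ContinuousLinearMap.coe_coe, wienerIntegral_apply_self]
  exact coeFn_linearCombination_toLp (fun i => hY.memLp (f i)) c

lemma exists_wienerIntegral_ae_eq_sum (hY : IsGaussianField k Y P) {g : H}
    (hg : g ∈ Submodule.span ℝ (Set.range k)) :
    ∃ c : ι →₀ ℝ, hY.wienerIntegral g =ᵐ[P] fun ω => ∑ s ∈ c.support, c s * Y s ω := by
  obtain ⟨c, rfl⟩ := Finsupp.mem_span_range_iff_exists_finsupp.1 hg
  exact ⟨c, hY.wienerIntegral_linearCombination_ae_eq id c⟩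

lemma hasGaussianLaw_wienerIntegral (hY : IsGaussianField k Y P) {g : H}
    (hg : g ∈ Submodule.span ℝ (Set.range k)) : HasGaussianLaw (hY.wienerIntegral g) P := by
  obtain ⟨c, hc⟩ := hY.exists_wienerIntegral_ae_eq_sum hg
  exact (hY.isGaussianProcess.smul c).hasGaussianLaw_fun_sum.congr hc.symm

lemma integral_wienerIntegral (hY : IsGaussianField k Y P) {g : H}
    (hg : g ∈ Submodule.span ℝ (Set.range k)) : ∫ ω, hY.wienerIntegral g ω ∂P = 0 := by
  have := hY.isGaussianProcess.isProbabilityMeasure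
  obtain ⟨c, hc⟩ := hY.exists_wienerIntegral_ae_eq_sum hg
  rw [integral_congr_ae hc, integral_finsetSum _ fun s _ =>
    ((hY.memLp s).integrable one_le_two).const_mul (c s)]
  simp only [integral_const_mul, hY.integral_eq_zero, mul_zero, Finset.sum_const_zero]

theorem exists_tendsto_of_tendstoInMeasure (hY : IsGaussianField k Y P) {g : ℕ → H} {F : Ω → ℝ}
    (hg : ∀ n, g n ∈ Submodule.span ℝ (Set.range k))
    (hF : TendstoInMeasure P (fun n => hY.wienerIntegral (g n)) atTop F) :
    ∃ h, Tendsto g atTop (𝓝 h) ∧ F =ᵐ[P] hY.wienerIntegral h := by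
  have hsub (m n : ℕ) : g m - g n ∈ Submodule.span ℝ (Set.range k) := sub_mem (hg m) (hg n)
  have hcauchy : CauchySeq fun n => hY.wienerIntegral (g n) :=
    cauchySeq_of_tendstoInMeasure_of_hasGaussianLaw
      (fun m n => by rw [← map_sub]; exact hY.hasGaussianLaw_wienerIntegral (hsub m n))
      (fun m n => by rw [← map_sub]; exact hY.integral_wienerIntegral (hsub m n)) hF
  have hdist (m n : ℕ) : dist (hY.wienerIntegral (g m)) (hY.wienerIntegral (g n)) =
      dist (g m) (g n) := by
    rw [dist_eq_norm, ← map_sub, hY.norm_wienerIntegral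
      (Submodule.le_topologicalClosure _ (hsub m n)), ← dist_eq_norm]
  obtain ⟨h, hh⟩ := cauchySeq_tendsto_of_complete (u := g) <| by
    simpa only [Metric.cauchySeq_iff, hdist] using hcauchy
  refine ⟨h, hh, tendstoInMeasure_ae_unique hF ?_⟩
  exact tendstoInMeasure_of_tendsto_Lp ((hY.wienerIntegral.continuous.tendsto h).comp hh)

end IsGaussianField

end GaussianField

section PathMeasure

variable {X : Type*} [MeasurableSpace X] {ν : Measure X} {K : Bfin ν → Bfin ν → ℝ}
  {P : Measure (PathSpace ν)}

lemma measurable_onePoint_elim_zero : Measurable fun y : OnePoint ℝ => (y.elim 0 id : ℝ) := by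
  intro s hs
  have hcoe : MeasurableSet (((↑) : ℝ → OnePoint ℝ) '' s) :=
    OnePoint.isOpenEmbedding_coe.measurableEmbedding.measurableSet_image.2 hs
  by_cases h0 : (0 : ℝ) ∈ s
  · convert hcoe.union (measurableSet_singleton (OnePoint.infty : OnePoint ℝ)) using 1
    ext y
    induction y using OnePoint.rec <;> simp [h0]
  · convert hcoe using 1
    ext y
    induction y using OnePoint.rec <;> simp [h0]

lemma measurable_W (ν : Measure X) (A : Bfin ν) : Measurable (W ν A) :=
  measurable_onePoint_elim_zero.comp (measurable_pi_apply A)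

lemma IsGaussianPathMeasure.hasLaw (hP : IsGaussianPathMeasure ν K P) {n : ℕ}
    (A : Fin n → Bfin ν) :
    HasLaw (fun ω => WithLp.toLp 2 fun i => W ν (A i) ω)
      (multivariateGaussian 0 (Matrix.of fun i j => K (A i) (A j))) P where
  aemeasurable := ((WithLp.measurable_toLp 2 _).comp
    (measurable_pi_lambda _ fun i => measurable_W ν (A i))).aemeasurable
  map_eq := by
    let retract (y : Fin n → OnePoint ℝ) : EuclideanSpace ℝ (Fin n) :=
      WithLp.toLp 2 fun i => (y i).elim 0 id
    have hretract : Measurable retract :=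
      (WithLp.measurable_toLp 2 _).comp (measurable_pi_lambda _ fun i =>
        measurable_onePoint_elim_zero.comp (measurable_pi_apply i))
    have hcoe : Measurable fun (x : EuclideanSpace ℝ (Fin n)) i => ((x i : ℝ) : OnePoint ℝ) :=
      measurable_pi_lambda _ fun i => OnePoint.continuous_coe.measurable.comp (by fun_prop)
    have hmap := congrArg (Measure.map retract) (hP n A)
    rw [Measure.map_map hretract (measurable_pi_lambda _ fun i => measurable_pi_apply (A i)),
      Measure.map_map hretract hcoe] at hmap
    exact hmap.trans Measure.map_id

lemma IsGaussianPathMeasure.isGaussianProcess_W (hP : IsGaussianPathMeasure ν K P) :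
    IsGaussianProcess (W ν) P where
  hasGaussianLaw I := by
    let e := I.equivFin
    let L : EuclideanSpace ℝ (Fin I.card) →L[ℝ] (I → ℝ) :=
      ContinuousLinearMap.pi fun A => EuclideanSpace.proj (e A)
    have hL : (fun ω => L (WithLp.toLp 2 fun i => W ν (e.symm i) ω)) =
        fun ω => I.restrict (W ν · ω) := by
      ext ω A
      simp [L]
    rw [← hL]
    exact (hP.hasLaw fun i => (e.symm i : Bfin ν)).hasGaussianLaw.map_fun L

lemma IsGaussianPathMeasure.integral_W (hP : IsGaussianPathMeasure ν K P) (A : Bfin ν) :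
    ∫ ω, W ν A ω ∂P = 0 := by
  have hproj := ContinuousLinearMap.integral_comp_comm (EuclideanSpace.proj (𝕜 := ℝ) (0 : Fin 1))
    (IsGaussian.integrable_fun_id
      (μ := multivariateGaussian 0 (Matrix.of fun _ _ : Fin 1 => K A A)))
  rw [integral_id_multivariateGaussian] at hproj
  exact ((hP.hasLaw fun _ : Fin 1 => A).integral_comp (by fun_prop)).trans hproj

variable {H : Type*} [NormedAddCommGroup H] [InnerProductSpace ℝ H] {k : Bfin ν → H}

lemma IsGaussianPathMeasure.covariance_W (hP : IsGaussianPathMeasure ν K P)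
    (hK : ∀ A B, K A B = inner ℝ (k A) (k B)) (A B : Bfin ν) :
    cov[W ν A, W ν B; P] = inner ℝ (k A) (k B) := by
  have hlaw := hP.hasLaw ![A, B]
  have hgram : (Matrix.of fun i j => K (![A, B] i) (![A, B] j)) =
      Matrix.gram ℝ fun i => k (![A, B] i) := by
    ext i j
    exact hK _ _
  rw [hgram] at hlaw
  have hcov := hlaw.covariance_comp (f := fun x => x 0) (g := fun x => x 1)
    (by fun_prop) (by fun_prop)
  rw [covariance_eval_multivariateGaussian (Matrix.posSemidef_gram ℝ _)] at hcov
  exact hcov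

theorem IsGaussianPathMeasure.isGaussianField (hP : IsGaussianPathMeasure ν K P)
    (hK : ∀ A B, K A B = inner ℝ (k A) (k B)) : IsGaussianField k (W ν) P where
  isGaussianProcess := hP.isGaussianProcess_W
  integral_eq_zero := hP.integral_W
  covariance_eq := hP.covariance_W hK

end PathMeasure

section StepFunction

variable {X : Type*} [MeasurableSpace X] {ν : Measure X}

namespace Partition

lemma step_apply (𝒜 : Partition ν) (α : ℕ →₀ ℝ) {x : X} {i : ℕ}
    (hx : x ∈ (𝒜.cell i : Set X)) : 𝒜.step α x = α i := by
  have hother (j : ℕ) (hji : j ≠ i) : x ∉ (𝒜.cell j : Set X) := fun hj =>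
    Set.disjoint_left.1 (𝒜.disjoint hji) hj hx
  rw [Partition.step, Finset.sum_eq_single i]
  · simp [hx]
  · exact fun j _ hji => by simp [hother j hji]
  · exact fun hi => by simp [Finsupp.notMem_support_iff.1 hi]

lemma step_ae_eq (𝒜 : Partition ν) (α : ℕ →₀ ℝ) :
    𝒜.step α =ᵐ[ν] Finsupp.linearCombination ℝ (fun i => chi ν (𝒜.cell i)) α :=
  (coeFn_linearCombination_toLp
    (fun i => memLp_indicator_const 2 (𝒜.cell i).2.1 (1 : ℝ) (.inr (𝒜.cell i).2.2.ne)) α).symm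

/-- The partition of `X` into the level sets of a labelling `g : X → ℕ`. -/
def ofFibers (g : X → ℕ) (hg : Measurable g) (hfin : ∀ n, ν (g ⁻¹' {n}) < ∞) : Partition ν where
  cell n := ⟨g ⁻¹' {n}, hg (measurableSet_singleton n), hfin n⟩
  disjoint _ _ hmn := Disjoint.preimage g (Set.disjoint_singleton.2 hmn)
  cover := by rw [← Set.preimage_iUnion, Set.iUnion_of_singleton, Set.preimage_univ]

end Partition

lemma exists_partition_step_eq_comp {ι : Type*} [Countable ι] [MeasurableSpace ι]
    [MeasurableSingletonClass ι] {g : X → ι} (hg : Measurable g)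
    (hfin : ∀ i, ν (g ⁻¹' {i}) < ∞) {a : ι → ℝ} (ha : a.support.Finite) :
    ∃ (𝒜 : Partition ν) (α : ℕ →₀ ℝ), ∀ x, 𝒜.step α x = a (g x) := by
  obtain ⟨f, hf⟩ := exists_injective_nat ι
  have hfibre (n : ℕ) : ν ((f ∘ g) ⁻¹' {n}) < ∞ := by
    rw [Set.preimage_comp]
    obtain hempty | ⟨i, hi⟩ :=
      (Set.subsingleton_singleton.preimage hf).eq_empty_or_singleton (s := f ⁻¹' {n})
    · simp only [hempty, Set.preimage_empty, measure_empty, ENNReal.zero_lt_top]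
    · simpa only [hi] using hfin i
  refine ⟨.ofFibers (f ∘ g) ((measurable_of_countable f).comp hg) hfibre,
    (Finsupp.ofSupportFinite a ha).mapDomain f, fun x => ?_⟩
  rw [Partition.step_apply _ _ (i := f (g x)) rfl, Finsupp.mapDomain_apply hf,
    Finsupp.ofSupportFinite_coe]

/-- The fibre over `b₀`, where the step function vanishes, is cut into pieces of finite measure. -/
lemma exists_partition_step_eq_comp_of_finite [SigmaFinite ν] {β : Type*} [Finite β]
    [MeasurableSpace β] [MeasurableSingletonClass β] {h : X → β} (hh : Measurable h) {b₀ : β}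
    (hfin : ∀ b ≠ b₀, ν (h ⁻¹' {b}) < ∞) {a : β → ℝ} (ha : a b₀ = 0) :
    ∃ (𝒜 : Partition ν) (α : ℕ →₀ ℝ), ∀ x, 𝒜.step α x = a (h x) := by
  classical
  let g (x : X) : β × ℕ := (h x, if h x = b₀ then spanningSetsIndex ν x else 0)
  have hg : Measurable g := hh.prodMk <|
    Measurable.ite (hh (measurableSet_singleton b₀)) (measurableSet_spanningSetsIndex ν)
      measurable_const
  have hgfin : ∀ p, ν (g ⁻¹' {p}) < ∞ := by
    rintro ⟨b, n⟩
    obtain rfl | hb := eq_or_ne b b₀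
    · refine (measure_mono fun x hx => ?_).trans_lt (measure_spanningSets_lt_top ν n)
      obtain ⟨hxb, hxn⟩ := Prod.ext_iff.1 hx
      rw [← show spanningSetsIndex ν x = n by simpa [g, show h x = b from hxb] using hxn]
      exact mem_spanningSetsIndex ν x
    · exact (measure_mono fun x hx => congrArg Prod.fst hx).trans_lt (hfin b hb)
  have hsupport : (Function.support fun p : β × ℕ => if p.2 = 0 then a p.1 else 0).Finite :=
    (Set.finite_range fun b : β => (b, 0)).subset fun p hp =>
      ⟨p.1, Prod.ext rfl (ite_ne_right_iff.1 hp).1.symm⟩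
  obtain ⟨𝒜, α, hα⟩ := exists_partition_step_eq_comp hg hgfin hsupport
  refine ⟨𝒜, α, fun x => (hα x).trans ?_⟩
  by_cases hx : h x = b₀ <;> simp [g, hx, ha]

lemma exists_partition_step_eq_sum [SigmaFinite ν] (c : Bfin ν →₀ ℝ) :
    ∃ (𝒜 : Partition ν) (α : ℕ →₀ ℝ),
      ∀ x, 𝒜.step α x = ∑ A ∈ c.support, c A * (A : Set X).indicator (fun _ => 1) x := by
  classical
  let atom (x : X) (A : c.support) : Prop := x ∈ (A : Bfin ν).1
  have hatom : Measurable atom :=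
    measurable_pi_lambda _ fun A => measurable_mem.2 A.1.2.1
  have hfin (p : c.support → Prop) (hp : p ≠ fun _ => False) : ν (atom ⁻¹' {p}) < ∞ := by
    obtain ⟨A, hA⟩ : ∃ A, p A := by
      by_contra! hnone
      exact hp (funext fun A => eq_false (hnone A))
    refine (measure_mono fun x (hx : atom x = p) => ?_).trans_lt A.1.2.2
    exact (congrFun hx A).mpr hA
  obtain ⟨𝒜, α, hα⟩ := exists_partition_step_eq_comp_of_finite hatom hfin
    (a := fun p => ∑ A : c.support, c A * if p A then 1 else 0) (by simp)
  refine ⟨𝒜, α, fun x => (hα x).trans ?_⟩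
  exact Finset.sum_coe_sort c.support fun A => c A * (A : Set X).indicator (fun _ => 1) x

lemma exists_partition_linearCombination_chi_eq [SigmaFinite ν] {u : Lp ℝ 2 ν}
    (hu : u ∈ Submodule.span ℝ (Set.range (chi ν))) :
    ∃ (𝒜 : Partition ν) (α : ℕ →₀ ℝ),
      Finsupp.linearCombination ℝ (fun i => chi ν (𝒜.cell i)) α = u := by
  obtain ⟨c, rfl⟩ := Finsupp.mem_span_range_iff_exists_finsupp.1 hu
  obtain ⟨𝒜, α, hstep⟩ := exists_partition_step_eq_sum c
  refine ⟨𝒜, α, Lp.ext ((𝒜.step_ae_eq α).symm.trans ?_)⟩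
  rw [funext hstep]
  exact (coeFn_linearCombination_toLp
    (fun A : Bfin ν => memLp_indicator_const 2 A.2.1 (1 : ℝ) (.inr A.2.2.ne)) c).symm

end StepFunction

section ItoIntegral

variable {X H : Type*} [MeasurableSpace X] {ν : Measure X} {P : Measure (PathSpace ν)}
  {φ : X → ℝ} {F : PathSpace ν → ℝ}

lemma IsItoIntegral.memLp_integrand (hF : IsItoIntegral ν P φ F) (hφ : AEMeasurable φ ν) :
    MemLp φ 2 ν := by
  obtain ⟨𝒜, α, hlim, -⟩ := hF
  obtain ⟨n, hn⟩ := (hlim.eventually (gt_mem_nhds ENNReal.zero_lt_top)).exists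
  have hstep : MemLp ((𝒜 n).step (α n)) 2 ν :=
    (memLp_congr_ae ((𝒜 n).step_ae_eq (α n))).2 (Lp.memLp _)
  have hsub : MemLp (fun x => (𝒜 n).step (α n) x - φ x) 2 ν :=
    ⟨hstep.1.sub hφ.aestronglyMeasurable, hn⟩
  simpa only [Pi.sub_def, sub_sub_cancel] using hstep.sub hsub

variable [NormedAddCommGroup H] [InnerProductSpace ℝ H] {k : Bfin ν → H}

lemma isItoIntegral_iff_exists_partition [CompleteSpace H] (hW : IsGaussianField k (W ν) P)
    (hφ : MemLp φ 2 ν) :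
    IsItoIntegral ν P φ F ↔ ∃ (𝒜 : ℕ → Partition ν) (α : ℕ → ℕ →₀ ℝ),
      Tendsto (fun n => Finsupp.linearCombination ℝ (fun i => chi ν ((𝒜 n).cell i)) (α n))
        atTop (𝓝 (hφ.toLp φ)) ∧
      TendstoInMeasure P (fun n => hW.wienerIntegral
        (Finsupp.linearCombination ℝ (fun i => k ((𝒜 n).cell i)) (α n))) atTop F := by
  refine exists_congr fun 𝒜 => exists_congr fun α => and_congr ?_ ?_
  · rw [Lp.tendsto_Lp_iff_tendsto_eLpNorm']
    exact tendsto_congr fun n =>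
      eLpNorm_congr_ae (((𝒜 n).step_ae_eq (α n)).sub hφ.coeFn_toLp.symm)
  · have hstep (n : ℕ) := hW.wienerIntegral_linearCombination_ae_eq (𝒜 n).cell (α n)
    exact ⟨fun h => h.congr_left fun n => (hstep n).symm, fun h => h.congr_left hstep⟩

variable {S : Lp ℝ 2 ν →ₗ.[ℝ] H}

theorem IsItoIntegral.exists_mem_graph [CompleteSpace H] (hF : IsItoIntegral ν P φ F)
    (hW : IsGaussianField k (W ν) P) (hS : S.IsClosed) (hSk : ∀ A, (chi ν A, k A) ∈ S.graph)
    (hφ : MemLp φ 2 ν) :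
    ∃ g ∈ (Submodule.span ℝ (Set.range k)).topologicalClosure,
      (hφ.toLp φ, g) ∈ S.graph ∧ F =ᵐ[P] hW.wienerIntegral g := by
  obtain ⟨𝒜, α, hφlim, hF⟩ := (isItoIntegral_iff_exists_partition hW hφ).1 hF
  have hspan (n : ℕ) : Finsupp.linearCombination ℝ (fun i => k ((𝒜 n).cell i)) (α n) ∈
      Submodule.span ℝ (Set.range k) :=
    Submodule.span_mono (Set.range_comp_subset_range (𝒜 n).cell k)
      (Finsupp.mem_span_range_iff_exists_finsupp.2 ⟨α n, rfl⟩)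
  obtain ⟨g, hg, hFg⟩ := hW.exists_tendsto_of_tendstoInMeasure hspan hF
  exact ⟨g, mem_closure_of_tendsto hg (.of_forall hspan),
    hS.mem_of_tendsto (hφlim.prodMk_nhds hg)
      (.of_forall fun n => linearCombination_mem_graph (fun i => hSk ((𝒜 n).cell i)) (α n)), hFg⟩

lemma IsItoIntegral.toLp_mem_domain [CompleteSpace H] (hF : IsItoIntegral ν P φ F)
    (hW : IsGaussianField k (W ν) P) (hS : S.IsClosed) (hSk : ∀ A, (chi ν A, k A) ∈ S.graph)
    (hφ : MemLp φ 2 ν) : hφ.toLp φ ∈ S.domain := by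
  obtain ⟨_, _, hgraph, _⟩ := hF.exists_mem_graph hW hS hSk hφ
  exact LinearPMap.mem_domain_of_mem_graph hgraph

lemma IsItoIntegral.memLp [CompleteSpace H] (hF : IsItoIntegral ν P φ F)
    (hW : IsGaussianField k (W ν) P) (hS : S.IsClosed) (hSk : ∀ A, (chi ν A, k A) ∈ S.graph)
    (hφ : MemLp φ 2 ν) : MemLp F 2 P := by
  obtain ⟨_, _, _, hFg⟩ := hF.exists_mem_graph hW hS hSk hφ
  exact (memLp_congr_ae hFg).2 (Lp.memLp _)

theorem IsItoIntegral.integral_mul_eq_inner [CompleteSpace H] (hF : IsItoIntegral ν P φ F)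
    {ψ : X → ℝ} {G : PathSpace ν → ℝ} (hG : IsItoIntegral ν P ψ G)
    (hW : IsGaussianField k (W ν) P) (hS : S.IsClosed) (hSk : ∀ A, (chi ν A, k A) ∈ S.graph)
    {hφ : MemLp φ 2 ν} {hψ : MemLp ψ 2 ν}
    (hdφ : hφ.toLp φ ∈ S.domain) (hdψ : hψ.toLp ψ ∈ S.domain) :
    ∫ ω, F ω * G ω ∂P = inner ℝ (S ⟨hφ.toLp φ, hdφ⟩) (S ⟨hψ.toLp ψ, hdψ⟩) := by
  obtain ⟨u, hu, hφu, hFu⟩ := hF.exists_mem_graph hW hS hSk hφ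
  obtain ⟨v, hv, hψv, hGv⟩ := hG.exists_mem_graph hW hS hSk hψ
  rw [S.mem_graph_snd_inj (S.mem_graph ⟨_, hdφ⟩) hφu rfl,
    S.mem_graph_snd_inj (S.mem_graph ⟨_, hdψ⟩) hψv rfl,
    integral_mul_eq_inner_of_ae_eq hFu hGv, hW.inner_wienerIntegral hu hv]

lemma exists_partition_linearCombination_eq [SigmaFinite ν]
    (hSk : ∀ A, (chi ν A, k A) ∈ S.graph)
    {w : Lp ℝ 2 ν × H} (hw : w ∈ Submodule.span ℝ (Set.range fun A => (chi ν A, k A))) :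
    ∃ (𝒜 : Partition ν) (α : ℕ →₀ ℝ),
      Finsupp.linearCombination ℝ (fun i => chi ν (𝒜.cell i)) α = w.1 ∧
      Finsupp.linearCombination ℝ (fun i => k (𝒜.cell i)) α = w.2 := by
  obtain ⟨𝒜, α, hα⟩ := exists_partition_linearCombination_chi_eq
    (fst_mem_span_of_mem_span_prodMk hw)
  exact ⟨𝒜, α, hα, S.mem_graph_snd_inj (linearCombination_mem_graph (fun i => hSk (𝒜.cell i)) α)
    (span_range_prodMk_le_graph hSk hw) hα⟩

theorem isItoIntegral_wienerIntegral [SigmaFinite ν] [CompleteSpace H]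
    (hW : IsGaussianField k (W ν) P) (hS : S.IsClosed) (hcore : S.HasCore (Dfin ν))
    (hSk : ∀ A, (chi ν A, k A) ∈ S.graph) (hφ : MemLp φ 2 ν) (hd : hφ.toLp φ ∈ S.domain) :
    IsItoIntegral ν P φ (hW.wienerIntegral (S ⟨hφ.toLp φ, hd⟩)) := by
  have hgraph := S.mem_graph ⟨hφ.toLp φ, hd⟩
  rw [graph_eq_topologicalClosure_span hS hcore hSk, ← SetLike.mem_coe,
    Submodule.topologicalClosure_coe, mem_closure_iff_seq_limit] at hgraph
  obtain ⟨w, hw, hlim⟩ := hgraph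
  choose 𝒜 α hchi hk using fun n => exists_partition_linearCombination_eq hSk (hw n)
  simp only [← hchi, ← hk, Prod.tendsto_iff] at hlim
  exact (isItoIntegral_iff_exists_partition hW hφ).2 ⟨𝒜, α, hlim.1,
    tendstoInMeasure_of_tendsto_Lp ((hW.wienerIntegral.continuous.tendsto _).comp hlim.2)⟩

end ItoIntegral

end KernelField

theorem theorem5p1_general {X H : Type*} [MeasurableSpace X] (ν : Measure X) [SigmaFinite ν]
    [NormedAddCommGroup H] [InnerProductSpace ℝ H] [CompleteSpace H]
    (K : KernelField.Bfin ν → KernelField.Bfin ν → ℝ)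
    (k : KernelField.Bfin ν → H)
    (hK : ∀ A B, K A B = inner ℝ (k A) (k B))
    (S : Lp ℝ 2 ν →ₗ.[ℝ] H)
    (hS : S.IsClosed) (hcore : S.HasCore (KernelField.Dfin ν))
    (hSk : ∀ A, (KernelField.chi ν A, k A) ∈ S.graph)
    (P : Measure (KernelField.PathSpace ν))
    (hP : KernelField.IsGaussianPathMeasure ν K P) :
    (∀ φ : X → ℝ, AEMeasurable φ ν →
      ((∃ F : KernelField.PathSpace ν → ℝ,
          KernelField.IsItoIntegral ν P φ F ∧ MemLp F 2 P) ↔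
        ∃ h : MemLp φ 2 ν, h.toLp φ ∈ S.domain)) ∧
    (∀ (φ : X → ℝ) (h : MemLp φ 2 ν) (hd : h.toLp φ ∈ S.domain)
        (F : KernelField.PathSpace ν → ℝ), KernelField.IsItoIntegral ν P φ F →
      MemLp F 2 P ∧ ∫ ω, |F ω| ^ 2 ∂P = ‖S ⟨h.toLp φ, hd⟩‖ ^ 2) ∧
    (∀ (φ ψ : X → ℝ) (hφ : MemLp φ 2 ν) (hψ : MemLp ψ 2 ν)
        (hdφ : hφ.toLp φ ∈ S.domain) (hdψ : hψ.toLp ψ ∈ S.domain)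
        (F G : KernelField.PathSpace ν → ℝ),
        KernelField.IsItoIntegral ν P φ F → KernelField.IsItoIntegral ν P ψ G →
      Integrable (fun ω => F ω * G ω) P ∧
      ∫ ω, F ω * G ω ∂P = inner ℝ (S ⟨hφ.toLp φ, hdφ⟩) (S ⟨hψ.toLp ψ, hdψ⟩)) := by
  have hW := hP.isGaussianField hK
  refine ⟨fun φ hφ => ⟨?_, ?_⟩, fun φ h hd F hF => ⟨?_, ?_⟩,
    fun φ ψ hφ hψ hdφ hdψ F G hF hG => ⟨?_, ?_⟩⟩
  · rintro ⟨F, hF, -⟩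
    exact ⟨hF.memLp_integrand hφ, hF.toLp_mem_domain hW hS hSk _⟩
  · rintro ⟨h, hd⟩
    exact ⟨_, KernelField.isItoIntegral_wienerIntegral hW hS hcore hSk h hd, Lp.memLp _⟩
  · exact hF.memLp hW hS hSk h
  · rw [← real_inner_self_eq_norm_sq, ← hF.integral_mul_eq_inner hF hW hS hSk hd hd]
    simp only [sq, abs_mul_abs_self]
  · exact (hF.memLp hW hS hSk hφ).integrable_mul (hG.memLp hW hS hSk hψ)
  · exact hF.integral_mul_eq_inner hG hW hS hSk hdφ hdψ

theorem theorem5p1 {X : Type*} [MeasurableSpace X] (ν : Measure X) [SigmaFinite ν]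
    (K : KernelField.Bfin ν → KernelField.Bfin ν → ℝ)
    (k : KernelField.Bfin ν → Lp ℝ 2 ν)
    (hK : ∀ A B, K A B = inner ℝ (k A) (k B))
    (S : Lp ℝ 2 ν →ₗ.[ℝ] Lp ℝ 2 ν)
    (hS : S.IsClosed) (hcore : S.HasCore (KernelField.Dfin ν))
    (hSk : ∀ A, (KernelField.chi ν A, k A) ∈ S.graph)
    (P : Measure (KernelField.PathSpace ν))
    (hP : KernelField.IsGaussianPathMeasure ν K P) :
    (∀ φ : X → ℝ, AEMeasurable φ ν →
      ((∃ F : KernelField.PathSpace ν → ℝ,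
          KernelField.IsItoIntegral ν P φ F ∧ MemLp F 2 P) ↔
        ∃ h : MemLp φ 2 ν, h.toLp φ ∈ S.domain)) ∧
    (∀ (φ : X → ℝ) (h : MemLp φ 2 ν) (hd : h.toLp φ ∈ S.domain)
        (F : KernelField.PathSpace ν → ℝ), KernelField.IsItoIntegral ν P φ F →
      MemLp F 2 P ∧ ∫ ω, |F ω| ^ 2 ∂P = ‖S ⟨h.toLp φ, hd⟩‖ ^ 2) ∧
    (∀ (φ ψ : X → ℝ) (hφ : MemLp φ 2 ν) (hψ : MemLp ψ 2 ν)
        (hdφ : hφ.toLp φ ∈ S.domain) (hdψ : hψ.toLp ψ ∈ S.domain)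
        (F G : KernelField.PathSpace ν → ℝ),
        KernelField.IsItoIntegral ν P φ F → KernelField.IsItoIntegral ν P ψ G →
      Integrable (fun ω => F ω * G ω) P ∧
      ∫ ω, F ω * G ω ∂P = inner ℝ (S ⟨hφ.toLp φ, hdφ⟩) (S ⟨hψ.toLp ψ, hdψ⟩)) :=
  theorem5p1_general ν K k hK S hS hcore hSk P hP
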